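/- Let $N$ be a positive integer with $N\equiv 0 \pmod 4$, let $\omega=e^{2\pi i/N}$ and $\tau=-e^{i\pi/N}$, and let $|0\rangle,\dots,|N-1\rangle$ be the standard orthonormal basis of $\mathbb{C}^N$, with indices read modulo $N$. Let $X,Z\in \mathrm{U}(N)$ be given by $X|j\rangle=|j-1\rangle$ and $Z|j\rangle=\omega^j|j\rangle$, and put $W(k,\ell)=\tau^{k\ell}X^kZ^\ell$; up to a phase factor, $W(u)$ is well defined for $u\in\mathbb{Z}_N^2$. Let the Heisenberg group $H(N)\le \mathrm{U}(N)$ be the subgroup generated by $X$, $Z$ and all scalar operators $\lambda I$ with $|\lambda|=1$, and let the Clifford group $C(N)$ be the normalizer of $H(N)$ in $\mathrm{U}(N)$. For $A,B\in\mathrm{U}(N)$ write $A\sim B$ if $A=\lambda B$ for some $\lambda\in\mathbb{C}$ with $|\lambda|=1$. There is a unique exact sequence $$1\to H(N)\xrightarrow{\ \iota\ } C(N)\xrightarrow{\ \pi\ }\mathrm{SL}(2,\mathbb{Z}_N)\to 1$$ in which $\iota$ is the inclusion and, for every $V\in C(N)$, $\pi(V)$ is the unique matrix $A\in \mathrm{SL}(2,\mathbb{Z}_N)$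 such that $V\,W(u)\,V^{-1}\sim W(Au)$ for all $u\in\mathbb{Z}_N^2$. The group $C(N)$ is not a semidirect product corresponding to this sequence, nor one corresponding to the sequence $$1\to H(N)\to C(N)\to C(N)/H(N)\to 1$$ of inclusion and quotient map; and neither of these two sequences is right splitting. Here, for an exact sequence of groups $1\to H\xrightarrow{i}G\xrightarrow{p}K\to1$, the group $G$ is called a semidirect product corresponding to the sequence if there are a homomorphism $\varphi:K\to\mathrm{Aut}(H)$ and an isomorphism $\Phi:K\ltimes_\varphi H\to G$ with $\Phi(1,h)=i(h)$ and $p(\Phi(x,1))=x$ for all $h\in H$, $x\in K$, where $K\ltimes_\varphi H$ is the set $K\times H$ with $(x,h)(y,g)=(xy,\,h\,\varphi(x)(g))$. The sequence is called right splitting if there is a homomorphism $\mu:K\to G$ with $p\circ\mu=\mathrm{id}_K$. -/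

import Mathlib

open scoped Matrix

noncomputable section

namespace CliffordSplit

/-! ### Group extensions and semidirect products -/

/-- The extension `1 → H → G → K → 1` (with maps `ι = S.inl` and `π = S.rightHom`) exhibits `G` as
a semidirect product: there are an action `φ : K → Aut H` and an isomorphism
`Φ : H ⋊[φ] K ≃* G` with `Φ (h, 1) = ι h` and `π (Φ (1, x)) = x`. -/
def IsSemidirect {H G K : Type*} [Group H] [Group G] [Group K] (S : GroupExtension H G K) : Prop :=
  ∃ (φ : K →* MulAut H) (Φ : (H ⋊[φ] K) ≃* G),
    (∀ h : H, Φ (SemidirectProduct.inl h) = S.inl h) ∧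
      ∀ x : K, S.rightHom (Φ (SemidirectProduct.inr x)) = x

/-- The extension is right splitting: `π` has a section that is a group homomorphism. -/
def IsRightSplit {H G K : Type*} [Group H] [Group G] [Group K] (S : GroupExtension H G K) : Prop :=
  ∃ μ : K →* G, S.rightHom.comp μ = MonoidHom.id K

/-! ### Unitary operators on `ℂ^N`

The orthonormal basis `|0⟩, …, |N-1⟩` of `ℂ^N` is indexed by `ZMod N`. -/

variable (N : ℕ) [NeZero N]

/-- The unitary group `U(N)`, as unitary matrices with rows and columns indexed by `ZMod N`. -/
abbrev U : Type := Matrix.unitaryGroup (ZMod N) ℂ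

/-- The primitive `N`-th root of unity `ω = exp(2πi/N)`. -/
def omega : Circle := Circle.exp (2 * Real.pi / N)

/-- `τ = -exp(iπ/N)`. -/
def tau : Circle := -Circle.exp (Real.pi / N)

/-- The scalar operator `c I`, for `c` of modulus one. -/
def scalar (c : Circle) : U N :=
  ⟨Matrix.diagonal fun _ => (c : ℂ), by
    rw [Matrix.mem_unitaryGroup_iff, Matrix.star_eq_conjTranspose, Matrix.diagonal_conjTranspose,
      Matrix.diagonal_mul_diagonal, ← Matrix.diagonal_one]
    congr 1
    funext i
    simp [Complex.mul_conj]⟩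

/-- The clock operator `Z |j⟩ = ω^j |j⟩`. -/
def clock : U N :=
  ⟨Matrix.diagonal fun j : ZMod N => ((omega N ^ j.val : Circle) : ℂ), by
    rw [Matrix.mem_unitaryGroup_iff, Matrix.star_eq_conjTranspose, Matrix.diagonal_conjTranspose,
      Matrix.diagonal_mul_diagonal, ← Matrix.diagonal_one]
    congr 1
    funext i
    rw [Pi.star_apply, Complex.star_def, Complex.mul_conj, Circle.normSq_coe, Complex.ofReal_one]⟩

/-- The shift operator `X |j⟩ = |j - 1 mod N⟩`; its entry in row `i` and column `j` is `1` if
`i = j - 1` and `0` otherwise. -/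
def shift : U N :=
  ⟨Matrix.of fun i j : ZMod N => if i = j - 1 then (1 : ℂ) else 0, by
    rw [Matrix.mem_unitaryGroup_iff]
    ext i k
    rw [Matrix.mul_apply, Finset.sum_eq_single (i + 1)]
    · simp [Matrix.star_apply, Matrix.one_apply, eq_comm]
    · intro j _ hj
      have h : i ≠ j - 1 := fun h => hj (by rw [h, sub_add_cancel])
      simp [h]
    · simp⟩

/-- The Weyl displacement operators `W(k, ℓ) = τ^{kℓ} X^k Z^ℓ`, for `k, ℓ ∈ ℤ`. -/
def weyl (k l : ℤ) : U N :=
  scalar N (tau N ^ (k * l)) * shift N ^ k * clock N ^ l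

/-- `W(u)` for `u ∈ (ℤ/N)²`, through the representatives in `{0, …, N-1}`; another choice of
representatives would change it by a phase factor only. -/
def weylVec (u : Fin 2 → ZMod N) : U N :=
  weyl N ((u 0).val : ℤ) ((u 1).val : ℤ)

variable {N} in
/-- `A ∼ B`: the unitary operators `A` and `B` agree up to a phase factor. -/
def PhaseEq (A B : U N) : Prop :=
  ∃ c : Circle, A = scalar N c * B

/-! ### The Heisenberg group and the Clifford group -/

/-- The Heisenberg group `H(N)`: the subgroup of `U(N)` generated by `X`, `Z` and all scalar
operators `c I` with `|c| = 1`. -/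
def heisenberg : Subgroup (U N) :=
  Subgroup.closure ({shift N, clock N} ∪ Set.range (scalar N))

/-- The Clifford group `C(N)`: the normalizer of `H(N)` in `U(N)`. -/
abbrev clifford : Subgroup (U N) :=
  Subgroup.normalizer (heisenberg N : Set (U N))

/-- The inclusion `H(N) → C(N)`. -/
def incl : heisenberg N →* clifford N :=
  Subgroup.inclusion Subgroup.le_normalizer

/-- The extension `1 → H(N) → C(N) → C(N)/H(N) → 1` of inclusion and quotient map. -/
def quotientExtension :
    GroupExtension (heisenberg N) (clifford N)
      (clifford N ⧸ (heisenberg N).subgroupOf (clifford N)) where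
  inl := incl N
  rightHom := QuotientGroup.mk' _
  inl_injective := Subgroup.inclusion_injective _
  range_inl_eq_ker_rightHom := by
    rw [QuotientGroup.ker_mk']
    exact Subgroup.inclusion_range _
  rightHom_surjective := QuotientGroup.mk'_surjective _

variable {N} in
/-- The extension is the sequence `1 → H(N) → C(N) → SL(2, ℤ/N) → 1` whose first map is the
inclusion, and whose second map `π` sends `V ∈ C(N)` to the unique matrix `A ∈ SL(2, ℤ/N)` with
`V W(u) V⁻¹ ∼ W(A u)` for every `u ∈ (ℤ/N)²`. -/
def IsCliffordExtension
    (S : GroupExtension (heisenberg N) (clifford N)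
      (Matrix.SpecialLinearGroup (Fin 2) (ZMod N))) : Prop :=
  S.inl = incl N ∧
    ∀ (V : clifford N) (A : Matrix.SpecialLinearGroup (Fin 2) (ZMod N)),
      S.rightHom V = A ↔
        ∀ u : Fin 2 → ZMod N,
          PhaseEq ((V : U N) * weylVec N u * (V : U N)⁻¹)
            (weylVec N ((A : Matrix (Fin 2) (Fin 2) (ZMod N)) *ᵥ u))

end CliffordSplit

end

/-!
Conjugation by a Clifford operator permutes the displacement operators `W(u)` up to phase. In the
projective unitary group the `W(u)` form a faithful image of `(ℤ/N)²` (`projWeyl`), so every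
`V ∈ C(N)` implements one matrix `A`; the Weyl relations (`weylVec_mul_comm`) say that the
commutator of `W(u)` and `W(v)` is `ω` to the power of the symplectic form, whence `det A = 1`.
The kernel of `V ↦ A` is `H(N)` (`implements_one_iff`): an operator fixing `X` and `Z` up to phase
agrees with some `W(u)` up to an operator commuting with both, which is scalar by irreducibility.
The map is onto because, for even `N`, the diagonal operator `D |j⟩ = τ^(j²) |j⟩` and the discrete
Fourier transform implement a transvection and a quarter turn, and these generate `SL(2, ℤ/N)`.

The extension does not split because of the commuting matrices `T = [1, 0; -1, 1]` and `-1`, with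
`T ^ N = 1`. They are implemented by `D` and by the parity operator `P |j⟩ = |-j⟩`, which commute,
so homomorphic lifts have the form `a ∼ W(u) D` and `b ∼ W(v) P`. Now `D ^ N = Z ^ (N / 2)` is not
a scalar, and `a ^ N = 1` forces `u₀` to be odd, while `a b = b a` forces `2 u₀ = 0` in `ℤ/N`. For
`4 ∣ N` these contradict each other (`not_commute_of_pow_eq_one`). The argument uses only the
images of `D` and `P` in `C(N)/H(N)`, so it covers both extensions, and a semidirect product
decomposition contains a splitting.
-/

noncomputable section

namespace CliffordSplit

/-! ### Generation of `SL(2, ℤ/N)` by two elements -/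

variable {N : ℕ}

/-- The upper triangular transvection. -/
def upper (x : ZMod N) : Matrix.SpecialLinearGroup (Fin 2) (ZMod N) :=
  ⟨!![1, x; 0, 1], by simp [Matrix.det_fin_two]⟩

/-- The lower triangular transvection. -/
def lower (x : ZMod N) : Matrix.SpecialLinearGroup (Fin 2) (ZMod N) :=
  ⟨!![1, 0; x, 1], by simp [Matrix.det_fin_two]⟩

variable (N) in
/-- The rotation by a quarter turn, implemented by the Fourier transform. -/
def quarterTurn : Matrix.SpecialLinearGroup (Fin 2) (ZMod N) :=
  ⟨!![0, 1; -1, 0], by simp [Matrix.det_fin_two]⟩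

lemma upper_coe (x : ZMod N) :
    (upper x : Matrix (Fin 2) (Fin 2) (ZMod N)) = !![1, x; 0, 1] := rfl

lemma lower_coe (x : ZMod N) :
    (lower x : Matrix (Fin 2) (Fin 2) (ZMod N)) = !![1, 0; x, 1] := rfl

lemma quarterTurn_coe :
    (quarterTurn N : Matrix (Fin 2) (Fin 2) (ZMod N)) = !![0, 1; -1, 0] := rfl

lemma lower_neg_natCast (k : ℕ) : lower (-(k : ZMod N)) = lower (-1) ^ k := by
  induction k with
  | zero =>
    apply Subtype.ext
    rw [pow_zero, Matrix.SpecialLinearGroup.coe_one, lower_coe, Matrix.one_fin_two]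
    simp
  | succ k ih =>
    rw [pow_succ, ← ih]
    apply Subtype.ext
    rw [Matrix.SpecialLinearGroup.coe_mul, lower_coe, lower_coe, lower_coe, Matrix.mul_fin_two]
    simp
    ring

lemma quarterTurn_mul_lower_neg (x : ZMod N) :
    quarterTurn N * lower (-x) = upper x * quarterTurn N := by
  apply Subtype.ext
  rw [Matrix.SpecialLinearGroup.coe_mul, Matrix.SpecialLinearGroup.coe_mul, lower_coe, upper_coe,
    quarterTurn_coe, Matrix.mul_fin_two, Matrix.mul_fin_two]
  simp

/-- A matrix of determinant one with invertible lower left entry is a product of transvections. -/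
lemma eq_upper_mul_lower_mul_upper (A : Matrix.SpecialLinearGroup (Fin 2) (ZMod N))
    (h : IsUnit (A.1 1 0)) :
    ∃ x y z, A = upper x * lower y * upper z := by
  obtain ⟨c', hc⟩ := h.exists_left_inv
  have hdet := A.2
  rw [Matrix.det_fin_two] at hdet
  refine ⟨(A.1 0 0 - 1) * c', A.1 1 0, (A.1 1 1 - 1) * c', ?_⟩
  apply Subtype.ext
  rw [Matrix.SpecialLinearGroup.coe_mul, Matrix.SpecialLinearGroup.coe_mul, upper_coe, lower_coe,
    upper_coe, Matrix.mul_fin_two, Matrix.mul_fin_two]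
  refine (Matrix.eta_fin_two A.1).trans ?_
  congr 1
  ext i j
  fin_cases i <;> fin_cases j <;> simp
  · linear_combination (1 - A.1 0 0) * hc
  · linear_combination (-c') * hdet - (A.1 0 1 + (A.1 0 0 - 1) * (A.1 1 1 - 1) * c') * hc
  · linear_combination (1 - A.1 1 1) * hc

variable [NeZero N]

/-- The ring `ℤ/N` has stable range one: a unimodular pair can be reduced to a unit. -/
lemma exists_isUnit_add_mul {a c : ZMod N} (h : IsCoprime a c) :
    ∃ t, IsUnit (c + t * a) := by
  obtain ⟨x, y, hxy⟩ := h
  -- `t` is the product of the primes dividing `N` but not `c`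
  set t : ℕ := ∏ p ∈ N.primeFactors.filter (fun p => ¬ p ∣ c.val), p with ht
  refine ⟨t, ?_⟩
  have hcast : c + t * a = ((c.val + t * a.val : ℕ) : ZMod N) := by
    push_cast
    rw [ZMod.natCast_zmod_val, ZMod.natCast_zmod_val]
  rw [hcast, ZMod.isUnit_iff_coprime]
  refine Nat.Coprime.symm (Nat.coprime_of_dvd ?_)
  intro p hp hpN hpd
  have hmem : p ∈ N.primeFactors := Nat.mem_primeFactors.2 ⟨hp, hpN, NeZero.ne N⟩
  by_cases hc : p ∣ c.val
  · have h1 : p ∣ t * a.val := (Nat.dvd_add_right hc).1 hpd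
    rcases hp.dvd_mul.1 h1 with h2 | h2
    · obtain ⟨q, hq, hpq⟩ := (hp.prime.dvd_finsetProd_iff _).1 h2
      obtain ⟨hq1, hq2⟩ := Finset.mem_filter.1 hq
      have : p = q := (Nat.prime_dvd_prime_iff_eq hp (Nat.prime_of_mem_primeFactors hq1)).1 hpq
      exact hq2 (this ▸ hc)
    · have h3 : ((x.val * a.val + y.val * c.val : ℕ) : ZMod N) = ((1 : ℕ) : ZMod N) := by
        push_cast
        simpa using hxy
      have h4 := ((ZMod.natCast_eq_natCast_iff _ _ _).1 h3).of_dvd hpN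
      have h5 : p ∣ 1 := (h4.dvd_iff dvd_rfl).1
        (dvd_add (Dvd.dvd.mul_left h2 _) (Dvd.dvd.mul_left hc _))
      exact hp.one_lt.ne' (Nat.dvd_one.1 h5)
  · have h1 : p ∣ t := Finset.dvd_prod_of_mem _ (Finset.mem_filter.2 ⟨hmem, hc⟩)
    exact hc ((Nat.dvd_add_left (h1.mul_right _)).1 hpd)

/-- `SL(2, ℤ/N)` is generated by a transvection and a quarter turn. -/
lemma eq_top_of_mem (K : Subgroup (Matrix.SpecialLinearGroup (Fin 2) (ZMod N)))
    (hT : lower (-1) ∈ K) (hS : quarterTurn N ∈ K) : K = ⊤ := by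
  have hL : ∀ x, lower x ∈ K := by
    intro x
    have := lower_neg_natCast (N := N) (-x).val
    rw [ZMod.natCast_zmod_val, neg_neg] at this
    rw [this]
    exact pow_mem hT _
  have hU : ∀ x, upper x ∈ K := by
    intro x
    rw [eq_mul_inv_iff_mul_eq.2 (quarterTurn_mul_lower_neg x).symm]
    exact mul_mem (mul_mem hS (hL _)) (inv_mem hS)
  rw [eq_top_iff]
  intro A _
  have hdet := A.2
  rw [Matrix.det_fin_two] at hdet
  -- a row operation makes the lower left entry invertible
  obtain ⟨t, ht⟩ := exists_isUnit_add_mul (a := A.1 0 0) (c := A.1 1 0)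
    ⟨A.1 1 1, -A.1 0 1, by linear_combination hdet⟩
  obtain ⟨x, y, z, h⟩ := eq_upper_mul_lower_mul_upper (lower t * A) (by
    convert ht using 1
    rw [Matrix.SpecialLinearGroup.coe_mul, lower_coe, Matrix.mul_apply, Fin.sum_univ_two]
    simp
    ring)
  rw [← Subgroup.mul_mem_cancel_left K (hL t), h]
  exact mul_mem (mul_mem (hU _) (hL _)) (hU _)

/-! ### Scalar operators and the projective unitary group -/

variable (N) in
/-- The scalar operators as a homomorphism `Circle →* U(N)`. -/
def scalarHom : Circle →* U N where
  toFun := scalar N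
  map_one' := by ext; simp [scalar, Matrix.diagonal, Matrix.one_apply]
  map_mul' c d := by ext; simp [scalar, Matrix.diagonal_mul_diagonal]

lemma scalar_mul (c d : Circle) : scalar N (c * d) = scalar N c * scalar N d :=
  map_mul (scalarHom N) c d

lemma scalar_one : scalar N 1 = 1 := map_one (scalarHom N)

lemma scalar_zpow (c : Circle) (k : ℤ) : scalar N (c ^ k) = scalar N c ^ k :=
  map_zpow (scalarHom N) c k

lemma scalar_pow (c : Circle) (k : ℕ) : scalar N (c ^ k) = scalar N c ^ k :=
  map_pow (scalarHom N) c k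

lemma scalar_injective : Function.Injective (scalar N) := by
  intro c d h
  have := congrFun (congrFun (congrArg Subtype.val h) 0) 0
  simpa [scalar, Circle.ext_iff] using this

lemma scalar_comm (c : Circle) (A : U N) : Commute (scalar N c) A := by
  ext i j
  simp [scalar, mul_comm]

instance : (scalarHom N).range.Normal where
  conj_mem := by
    rintro _ ⟨c, rfl⟩ g
    refine ⟨c, ?_⟩
    rw [eq_mul_inv_iff_mul_eq]
    exact (scalar_comm c g).eq

variable (N) in
/-- The projective unitary group: unitary operators up to phase. -/
abbrev PU : Type := U N ⧸ (scalarHom N).range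

lemma phaseEq_iff {A B : U N} : PhaseEq A B ↔ (A : PU N) = (B : PU N) := by
  rw [eq_comm, QuotientGroup.eq]
  constructor
  · rintro ⟨c, rfl⟩
    exact ⟨c, by rw [(scalar_comm c B).eq]; simp [scalarHom]⟩
  · rintro ⟨c, hc⟩
    refine ⟨c, ?_⟩
    rw [(scalar_comm c B).eq, show scalar N c = B⁻¹ * A from hc]
    simp

lemma mk_scalar (c : Circle) : ((scalar N c : U N) : PU N) = 1 := by
  rw [QuotientGroup.eq_one_iff]
  exact ⟨c, rfl⟩

lemma mk_eq_one_iff {A : U N} : (A : PU N) = 1 ↔ ∃ c, A = scalar N c := by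
  rw [QuotientGroup.eq_one_iff]
  exact ⟨fun ⟨c, h⟩ => ⟨c, h.symm⟩, fun ⟨c, h⟩ => ⟨c, h.symm⟩⟩

/-! ### Weyl commutation relations -/

/-- If `x` and `z` commute up to a central element `s`, then their powers commute up to a power
of `s`. -/
lemma zpow_mul_zpow_of_mul_eq {G : Type*} [Group G] {x z s : G} (hs : ∀ g, Commute s g)
    (h : x * z = s * (z * x)) (a b : ℤ) : x ^ a * z ^ b = s ^ (a * b) * (z ^ b * x ^ a) := by
  have h1 : z * x * z⁻¹ = s⁻¹ * x := by
    rw [mul_inv_eq_iff_eq_mul, mul_assoc, h]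
    simp
  have h2 : z * x ^ a * z⁻¹ = s ^ (-a) * x ^ a := by
    rw [← conj_zpow, h1, ((hs x).inv_left).mul_zpow, inv_zpow, zpow_neg]
  have h3 : x ^ a * z * (x ^ a)⁻¹ = s ^ a * z := by
    rw [mul_inv_eq_iff_eq_mul]
    rw [mul_inv_eq_iff_eq_mul] at h2
    rw [mul_assoc, h2, zpow_neg]
    simp [mul_assoc]
  have h4 : x ^ a * z ^ b * (x ^ a)⁻¹ = s ^ (a * b) * z ^ b := by
    rw [← conj_zpow, h3, ((hs z).zpow_left a).mul_zpow, zpow_mul]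
  rw [mul_inv_eq_iff_eq_mul] at h4
  rw [h4, mul_assoc]

lemma omega_eq : omega N = ZMod.toCircle (1 : ZMod N) := by
  ext
  have := ZMod.toCircle_natCast (N := N) 1
  rw [Nat.cast_one] at this
  rw [this, omega, Circle.coe_exp]
  congr 1
  push_cast
  ring

lemma omega_pow (k : ℕ) : omega N ^ k = ZMod.toCircle (k : ZMod N) := by
  rw [omega_eq, ← AddChar.map_nsmul_eq_pow, nsmul_one]

lemma omega_zpow (k : ℤ) : omega N ^ k = ZMod.toCircle (k : ZMod N) := by
  rw [omega_eq, ← AddChar.map_zsmul_eq_zpow, zsmul_one]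

lemma clock_coe : ((clock N : U N) : Matrix (ZMod N) (ZMod N) ℂ) =
    Matrix.diagonal fun j => ((ZMod.toCircle j : Circle) : ℂ) := by
  simp [clock, omega_pow]

lemma shift_mul_apply (A : Matrix (ZMod N) (ZMod N) ℂ) (i j : ZMod N) :
    ((shift N : Matrix (ZMod N) (ZMod N) ℂ) * A) i j = A (i + 1) j := by
  rw [Matrix.mul_apply, Finset.sum_eq_single (i + 1)]
  · simp [shift]
  · intro k _ hk
    have h : i ≠ k - 1 := fun h => hk (by rw [h, sub_add_cancel])
    simp [shift, h]
  · simp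

lemma mul_shift_apply (A : Matrix (ZMod N) (ZMod N) ℂ) (i j : ZMod N) :
    (A * (shift N : Matrix (ZMod N) (ZMod N) ℂ)) i j = A i (j - 1) := by
  rw [Matrix.mul_apply, Finset.sum_eq_single (j - 1)]
  · simp [shift]
  · intro k _ hk
    simp [shift, hk]
  · simp

lemma clock_mul_apply (A : Matrix (ZMod N) (ZMod N) ℂ) (i j : ZMod N) :
    ((clock N : Matrix (ZMod N) (ZMod N) ℂ) * A) i j = ZMod.toCircle i * A i j := by
  rw [clock_coe, Matrix.diagonal_mul]

lemma mul_clock_apply (A : Matrix (ZMod N) (ZMod N) ℂ) (i j : ZMod N) :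
    (A * (clock N : Matrix (ZMod N) (ZMod N) ℂ)) i j = A i j * ZMod.toCircle j := by
  rw [clock_coe, Matrix.mul_diagonal]

lemma scalar_mul_apply (c : Circle) (A : Matrix (ZMod N) (ZMod N) ℂ) (i j : ZMod N) :
    ((scalar N c : Matrix (ZMod N) (ZMod N) ℂ) * A) i j = c * A i j := by
  simp [scalar]

lemma shift_apply (i j : ZMod N) :
    (shift N : Matrix (ZMod N) (ZMod N) ℂ) i j = if i = j - 1 then 1 else 0 := rfl

lemma shift_mul_clock : shift N * clock N = scalar N (omega N) * (clock N * shift N) := by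
  ext i j
  simp only [Submonoid.coe_mul]
  rw [mul_clock_apply, scalar_mul_apply, clock_mul_apply, shift_apply, omega_eq]
  split_ifs with h
  · rw [mul_one, one_mul, ← Circle.coe_mul, ← AddChar.map_add_eq_mul, h]
    simp
  · simp

lemma shift_pow_mul_apply (k : ℕ) (A : U N) (i j : ZMod N) :
    ((shift N ^ k * A : U N) : Matrix (ZMod N) (ZMod N) ℂ) i j =
      (A : Matrix (ZMod N) (ZMod N) ℂ) (i + k) j := by
  induction k generalizing i with
  | zero => simp
  | succ k ih =>
    rw [pow_succ', mul_assoc, Submonoid.coe_mul, shift_mul_apply, ih]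
    push_cast
    ring_nf

lemma shift_pow_card : shift N ^ N = 1 := by
  ext i j
  have := shift_pow_mul_apply N (1 : U N) i j
  simpa using this

lemma diagonal_pow_coe {D : U N} {d : ZMod N → ℂ}
    (hD : (D : Matrix (ZMod N) (ZMod N) ℂ) = Matrix.diagonal d) (k : ℕ) :
    ((D ^ k : U N) : Matrix (ZMod N) (ZMod N) ℂ) = Matrix.diagonal (d ^ k) := by
  rw [SubmonoidClass.coe_pow, hD, Matrix.diagonal_pow]

lemma toCircle_pow_card (j : ZMod N) : (ZMod.toCircle j) ^ N = 1 := by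
  rw [← AddChar.map_nsmul_eq_pow]
  simp

lemma clock_pow_card : clock N ^ N = 1 := by
  ext i j
  rw [diagonal_pow_coe clock_coe, show ((fun j : ZMod N => ((ZMod.toCircle j : Circle) : ℂ)) ^ N)
    = fun _ => 1 from funext fun j => by
      rw [Pi.pow_apply, ← Circle.coe_pow, toCircle_pow_card, Circle.coe_one]]
  simp

/-- The symplectic form on `(ℤ/N)²`. -/
def symp (u v : Fin 2 → ZMod N) : ZMod N := u 0 * v 1 - u 1 * v 0

lemma shift_zpow_mul_clock_zpow (a b : ℤ) :
    shift N ^ a * clock N ^ b = scalar N (omega N ^ (a * b)) * (clock N ^ b * shift N ^ a) := by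
  rw [scalar_zpow]
  exact zpow_mul_zpow_of_mul_eq (scalar_comm _) shift_mul_clock a b

/-- Commutation up to a given phase is insensitive to the phases of the two operators. -/
lemma mul_eq_scalar_mul_congr {A B A' B' : U N} (hA : PhaseEq A A') (hB : PhaseEq B B')
    {c : Circle} (h : A' * B' = scalar N c * (B' * A')) :
    A * B = scalar N c * (B * A) := by
  obtain ⟨a, rfl⟩ := hA
  obtain ⟨b, rfl⟩ := hB
  have e1 : scalar N a * A' * (scalar N b * B') = scalar N a * scalar N b * (A' * B') := by
    rw [mul_assoc, ← mul_assoc A', ← (scalar_comm b A').eq]; simp only [mul_assoc]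
  have e2 : scalar N b * B' * (scalar N a * A') = scalar N a * scalar N b * (B' * A') := by
    rw [mul_assoc, ← mul_assoc B', ← (scalar_comm a B').eq, (scalar_comm a (scalar N b)).eq]
    simp only [mul_assoc]
  rw [e1, e2, h, (scalar_comm c (scalar N a * scalar N b)).left_comm]

lemma weylVec_phaseEq (u : Fin 2 → ZMod N) :
    PhaseEq (weylVec N u) (shift N ^ (u 0).val * clock N ^ (u 1).val) :=
  ⟨tau N ^ (((u 0).val : ℤ) * ((u 1).val : ℤ)), by
    simp only [weylVec, weyl, zpow_natCast, mul_assoc]⟩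

lemma phaseEq_refl (A : U N) : PhaseEq A A := ⟨1, by rw [scalar_one, one_mul]⟩

/-- The Weyl relations: displacement operators commute up to the phase given by the symplectic
form. -/
lemma weylVec_mul_comm (u v : Fin 2 → ZMod N) :
    weylVec N u * weylVec N v =
      scalar N (ZMod.toCircle (symp u v)) * (weylVec N v * weylVec N u) := by
  refine mul_eq_scalar_mul_congr (weylVec_phaseEq u) (weylVec_phaseEq v) ?_
  obtain ⟨a, ha⟩ : ∃ a : ℤ, a = (u 0).val := ⟨_, rfl⟩
  obtain ⟨b, hb⟩ : ∃ b : ℤ, b = (u 1).val := ⟨_, rfl⟩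
  obtain ⟨c, hc⟩ : ∃ c : ℤ, c = (v 0).val := ⟨_, rfl⟩
  obtain ⟨d, hd⟩ : ∃ d : ℤ, d = (v 1).val := ⟨_, rfl⟩
  have hs : symp u v = ((a * d - b * c : ℤ) : ZMod N) := by
    rw [ha, hb, hc, hd]
    simp [symp]
  rw [hs, ← omega_zpow]
  simp only [← zpow_natCast]
  rw [← ha, ← hb, ← hc, ← hd]
  -- both products are rewritten as a phase times `X^(a+c) Z^(d+b)`
  have key : ∀ a b c d : ℤ, shift N ^ a * clock N ^ b * (shift N ^ c * clock N ^ d) =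
      scalar N (omega N ^ (-(b * c))) * (shift N ^ (a + c) * clock N ^ (b + d)) := by
    intro a b c d
    have h := shift_zpow_mul_clock_zpow (N := N) c b
    have h' : clock N ^ b * shift N ^ c =
        scalar N (omega N ^ (-(b * c))) * (shift N ^ c * clock N ^ b) := by
      rw [h, ← mul_assoc, ← scalar_mul, ← zpow_add,
        show -(b * c) + c * b = 0 by ring, zpow_zero, scalar_one, one_mul]
    rw [mul_assoc, ← mul_assoc (clock N ^ b), h', zpow_add, zpow_add]
    simp only [← mul_assoc]
    rw [(scalar_comm _ (shift N ^ a)).eq]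
  rw [key, key, ← mul_assoc (scalar N _) (scalar N _), ← scalar_mul, ← zpow_add, add_comm c a,
    add_comm d b]
  congr 3
  ring_nf

/-! ### The projective Weyl representation -/

lemma mk_weylVec (u : Fin 2 → ZMod N) :
    ((weylVec N u : U N) : PU N) =
      ((shift N : U N) : PU N) ^ (u 0).val * ((clock N : U N) : PU N) ^ (u 1).val := by
  rw [phaseEq_iff.1 (weylVec_phaseEq u)]
  rfl

lemma pow_val_add {G : Type*} [Group G] {g : G} (hg : g ^ N = 1) (a b : ZMod N) :
    g ^ (a + b).val = g ^ a.val * g ^ b.val := by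
  rw [← pow_add, ZMod.val_add, ← pow_eq_pow_mod _ hg]

variable (N) in
/-- The class in the projective unitary group of the displacement operator `W(u)`. -/
def projWeyl (u : Fin 2 → ZMod N) : PU N := (weylVec N u : U N)

lemma mk_shift_pow_card : ((shift N : U N) : PU N) ^ N = 1 := by
  rw [← QuotientGroup.mk_pow, shift_pow_card, QuotientGroup.mk_one]

lemma mk_clock_pow_card : ((clock N : U N) : PU N) ^ N = 1 := by
  rw [← QuotientGroup.mk_pow, clock_pow_card, QuotientGroup.mk_one]

lemma mk_shift_commute_mk_clock : Commute ((shift N : U N) : PU N) ((clock N : U N) : PU N) := by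
  have := congrArg (fun A : U N => (A : PU N)) (shift_mul_clock (N := N))
  simpa [QuotientGroup.mk_mul, mk_scalar, commute_iff_eq] using this

lemma projWeyl_add (u v : Fin 2 → ZMod N) :
    projWeyl N (u + v) = projWeyl N u * projWeyl N v := by
  simp only [projWeyl, mk_weylVec, Pi.add_apply]
  rw [pow_val_add mk_shift_pow_card, pow_val_add mk_clock_pow_card]
  simp only [mul_assoc]
  rw [← mul_assoc (_ ^ (v 0).val), (mk_shift_commute_mk_clock.pow_pow _ _).eq]
  simp only [mul_assoc]

lemma projWeyl_zero : projWeyl N 0 = 1 := by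
  have := projWeyl_add (N := N) 0 0
  simpa using this

lemma projWeyl_neg (u : Fin 2 → ZMod N) : projWeyl N (-u) = (projWeyl N u)⁻¹ := by
  rw [eq_inv_iff_mul_eq_one, ← projWeyl_add, neg_add_cancel, projWeyl_zero]

lemma pow_val_natCast {n : ℕ} {G : Type*} [Group G] {g : G} (hg : g ^ n = 1) (k : ℕ) :
    g ^ (k : ZMod n).val = g ^ k := by
  rw [ZMod.val_natCast, ← pow_eq_pow_mod _ hg]

lemma projWeyl_natCast (k l : ℕ) :
    projWeyl N ![k, l] = ((shift N : U N) : PU N) ^ k * ((clock N : U N) : PU N) ^ l := by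
  simp only [projWeyl, mk_weylVec, Matrix.cons_val_zero, Matrix.cons_val_one]
  rw [pow_val_natCast mk_shift_pow_card, pow_val_natCast mk_clock_pow_card]

lemma projWeyl_shift : projWeyl N ![1, 0] = (shift N : U N) := by
  simpa using projWeyl_natCast (N := N) 1 0

lemma projWeyl_clock : projWeyl N ![0, 1] = (clock N : U N) := by
  simpa using projWeyl_natCast (N := N) 0 1

/-- A displacement operator that is a scalar has index `0`, since the symplectic form is
nondegenerate. -/
lemma eq_zero_of_projWeyl_eq_one {u : Fin 2 → ZMod N} (h : projWeyl N u = 1) : u = 0 := by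
  obtain ⟨c, hc⟩ := mk_eq_one_iff.1 h
  have key : ∀ v, symp u v = 0 := by
    intro v
    have h1 := weylVec_mul_comm u v
    rw [hc, (scalar_comm c (weylVec N v)).eq] at h1
    have h2 := right_eq_mul.1 h1
    rw [← scalar_one] at h2
    have h3 := scalar_injective h2
    rw [← AddChar.map_zero_eq_one (ZMod.toCircle (N := N))] at h3
    exact ZMod.injective_toCircle h3
  have k0 := key ![0, 1]
  have k1 := key ![1, 0]
  simp only [symp, Matrix.cons_val_zero, Matrix.cons_val_one] at k0 k1
  ext i
  fin_cases i
  · simpa using k0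
  · simpa using k1

lemma projWeyl_injective : Function.Injective (projWeyl N) := by
  intro u v h
  rw [← sub_eq_zero]
  apply eq_zero_of_projWeyl_eq_one
  rw [sub_eq_add_neg, projWeyl_add, projWeyl_neg, h, mul_inv_cancel]

/-! ### The Heisenberg group -/

lemma scalar_mem_heisenberg (c : Circle) : scalar N c ∈ heisenberg N :=
  Subgroup.subset_closure (Or.inr ⟨c, rfl⟩)

lemma shift_mem_heisenberg : shift N ∈ heisenberg N :=
  Subgroup.subset_closure (Or.inl (by simp))

lemma clock_mem_heisenberg : clock N ∈ heisenberg N :=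
  Subgroup.subset_closure (Or.inl (by simp))

lemma weylVec_mem_heisenberg (u : Fin 2 → ZMod N) : weylVec N u ∈ heisenberg N :=
  mul_mem (mul_mem (scalar_mem_heisenberg _) (zpow_mem shift_mem_heisenberg _))
    (zpow_mem clock_mem_heisenberg _)

/-- The Heisenberg group consists of the displacement operators, up to phase. -/
lemma mem_heisenberg_iff {A : U N} : A ∈ heisenberg N ↔ ∃ u, (A : PU N) = projWeyl N u := by
  constructor
  · intro h
    induction h using Subgroup.closure_induction with
    | mem x hx =>
      rcases hx with hx | ⟨c, rfl⟩
      · rcases hx with rfl | rfl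
        · exact ⟨_, projWeyl_shift.symm⟩
        · exact ⟨_, projWeyl_clock.symm⟩
      · exact ⟨0, by rw [mk_scalar, projWeyl_zero]⟩
    | one => exact ⟨0, by rw [QuotientGroup.mk_one, projWeyl_zero]⟩
    | mul x y _ _ hx hy =>
      obtain ⟨u, hu⟩ := hx
      obtain ⟨v, hv⟩ := hy
      exact ⟨u + v, by rw [QuotientGroup.mk_mul, hu, hv, projWeyl_add]⟩
    | inv x _ hx =>
      obtain ⟨u, hu⟩ := hx
      exact ⟨-u, by rw [QuotientGroup.mk_inv, hu, projWeyl_neg]⟩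
  · rintro ⟨u, hu⟩
    obtain ⟨c, rfl⟩ := phaseEq_iff.2 hu
    exact mul_mem (scalar_mem_heisenberg c) (weylVec_mem_heisenberg u)

/-- The Weyl representation is irreducible: only scalars commute with both `X` and `Z`. -/
lemma exists_eq_scalar_of_commute {A : U N} (hX : Commute A (shift N))
    (hZ : Commute A (clock N)) : ∃ c, A = scalar N c := by
  set M : Matrix (ZMod N) (ZMod N) ℂ := A.1 with hM
  have hdiag : ∀ i j, i ≠ j → M i j = 0 := by
    intro i j hij
    have h := congrFun (congrFun (congrArg Subtype.val hZ.eq) i) j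
    simp only [Submonoid.coe_mul] at h
    rw [mul_clock_apply, clock_mul_apply, mul_comm] at h
    have h' : (((ZMod.toCircle j : Circle) : ℂ) - (ZMod.toCircle i : Circle)) * M i j = 0 := by
      rw [sub_mul, sub_eq_zero]; exact h
    rcases mul_eq_zero.1 h' with h0 | h0
    · exact absurd (ZMod.injective_toCircle (Circle.coe_injective (sub_eq_zero.1 h0))).symm hij
    · exact h0
  have hstep : ∀ i, M (i + 1) (i + 1) = M i i := by
    intro i
    have h := congrFun (congrFun (congrArg Subtype.val hX.eq) i) (i + 1)
    simp only [Submonoid.coe_mul] at h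
    rw [mul_shift_apply, shift_mul_apply, add_sub_cancel_right] at h
    exact h.symm
  have hconst : ∀ i, M i i = M 0 0 := by
    have : ∀ k : ℕ, M k k = M 0 0 := by
      intro k
      induction k with
      | zero => simp
      | succ k ih => push_cast; rw [hstep, ih]
    intro i
    have := this i.val
    rwa [ZMod.natCast_zmod_val] at this
  have hMd : M = Matrix.diagonal fun _ => M 0 0 := by
    ext i j
    by_cases hij : i = j
    · subst hij; simp [hconst i]
    · simp [hij, hdiag i j hij]
  have hnorm : M 0 0 * star (M 0 0) = 1 := by
    have h := A.2
    rw [Matrix.mem_unitaryGroup_iff, ← hM, hMd, Matrix.star_eq_conjTranspose,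
      Matrix.diagonal_conjTranspose, Matrix.diagonal_mul_diagonal, ← Matrix.diagonal_one] at h
    exact congrFun (Matrix.diagonal_injective h) 0
  have hmem : M 0 0 ∈ Submonoid.unitSphere ℂ := by
    rw [Submonoid.unitSphere, ← SetLike.mem_coe]
    have : ‖M 0 0‖ * ‖M 0 0‖ = 1 := by
      have := congrArg norm hnorm
      simpa using this
    have h1 : ‖M 0 0‖ = 1 := by nlinarith [norm_nonneg (M 0 0)]
    simpa using h1
  exact ⟨⟨M 0 0, hmem⟩, Subtype.ext hMd⟩

/-! ### Symplectic action of Clifford operators -/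

/-- The unitary operator `V` implements the matrix `A`: conjugation by `V` sends `W(u)` to `W(A u)`
up to phase. -/
def Implements (V : U N) (A : Matrix (Fin 2) (Fin 2) (ZMod N)) : Prop :=
  ∀ u, (V : PU N) * projWeyl N u * (V : PU N)⁻¹ = projWeyl N (A *ᵥ u)

lemma implements_iff {V : U N} {A : Matrix (Fin 2) (Fin 2) (ZMod N)} :
    Implements V A ↔ ∀ u, PhaseEq (V * weylVec N u * V⁻¹) (weylVec N (A *ᵥ u)) := by
  simp only [phaseEq_iff]
  rfl

lemma Implements.mul {V V' : U N} {A A' : Matrix (Fin 2) (Fin 2) (ZMod N)}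
    (h : Implements V A) (h' : Implements V' A') : Implements (V * V') (A * A') := by
  intro u
  rw [← Matrix.mulVec_mulVec, ← h, ← h', QuotientGroup.mk_mul]
  group

lemma Implements.eq {V : U N} {A A' : Matrix (Fin 2) (Fin 2) (ZMod N)}
    (h : Implements V A) (h' : Implements V A') : A = A' := by
  apply Matrix.ext_of_mulVec_single
  intro i
  exact projWeyl_injective ((h _).symm.trans (h' _))

/-- It is enough to check the action of a unitary operator on the generators `X` and `Z`. -/
lemma implements_of_generators {V : U N} {a b c d : ZMod N}
    (hX : (V : PU N) * (shift N : U N) * (V : PU N)⁻¹ = projWeyl N ![a, c])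
    (hZ : (V : PU N) * (clock N : U N) * (V : PU N)⁻¹ = projWeyl N ![b, d]) :
    Implements V !![a, b; c, d] := by
  have hpow : ∀ (k : ℕ) (v : Fin 2 → ZMod N), projWeyl N v ^ k = projWeyl N (k • v) := by
    intro k v
    induction k with
    | zero => rw [pow_zero, zero_smul, projWeyl_zero]
    | succ k ih => rw [pow_succ, ih, add_smul, one_smul, projWeyl_add]
  intro u
  conv_lhs => rw [projWeyl, mk_weylVec, ← conj_mul, ← conj_pow, ← conj_pow, hX, hZ, hpow, hpow,
    ← projWeyl_add]
  congr 1
  ext i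
  fin_cases i <;> simp [Matrix.mulVec, dotProduct, Fin.sum_univ_two, mul_comm]

/-- Conjugation preserves commutators, so an implemented matrix preserves the symplectic form. -/
lemma Implements.det_eq_one {V : U N} {A : Matrix (Fin 2) (Fin 2) (ZMod N)}
    (h : Implements V A) : A.det = 1 := by
  rw [implements_iff] at h
  have h1 := weylVec_mul_comm (N := N) ![1, 0] ![0, 1]
  have h2 : V * weylVec N ![1, 0] * V⁻¹ * (V * weylVec N ![0, 1] * V⁻¹) =
      scalar N (ZMod.toCircle (symp (N := N) ![1, 0] ![0, 1])) *
        (V * weylVec N ![0, 1] * V⁻¹ * (V * weylVec N ![1, 0] * V⁻¹)) := by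
    rw [conj_mul, conj_mul, h1, ← mul_assoc V, ← (scalar_comm _ V).eq]
    simp only [mul_assoc]
  have h3 := mul_eq_scalar_mul_congr (h ![1, 0]) (h ![0, 1]) (weylVec_mul_comm _ _)
  have h4 := ZMod.injective_toCircle (scalar_injective (mul_right_cancel (h3.symm.trans h2)))
  simp [symp, Matrix.mulVec, dotProduct, Fin.sum_univ_two] at h4
  rw [Matrix.det_fin_two, ← h4]
  ring

lemma exists_implements_of_mem_clifford {V : U N} (hV : V ∈ clifford N) :
    ∃ A : Matrix.SpecialLinearGroup (Fin 2) (ZMod N), Implements V A := by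
  obtain ⟨u, hu⟩ := mem_heisenberg_iff.1
    ((Subgroup.mem_normalizer_iff.1 hV _).1 (shift_mem_heisenberg (N := N)))
  obtain ⟨v, hv⟩ := mem_heisenberg_iff.1
    ((Subgroup.mem_normalizer_iff.1 hV _).1 (clock_mem_heisenberg (N := N)))
  have h : Implements V !![u 0, v 0; u 1, v 1] := by
    apply implements_of_generators
    · rw [show ![u 0, u 1] = u by ext i; fin_cases i <;> rfl, ← hu]
      rfl
    · rw [show ![v 0, v 1] = v by ext i; fin_cases i <;> rfl, ← hv]
      rfl
  exact ⟨⟨_, h.det_eq_one⟩, h⟩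

lemma Implements.mem_clifford {V : U N} {A : Matrix.SpecialLinearGroup (Fin 2) (ZMod N)}
    (h : Implements V A) : V ∈ clifford N := by
  rw [Subgroup.mem_normalizer_iff]
  intro g
  simp only [mem_heisenberg_iff, QuotientGroup.mk_mul, QuotientGroup.mk_inv]
  constructor
  · rintro ⟨u, hu⟩
    exact ⟨_, by rw [hu, h u]⟩
  · rintro ⟨v, hv⟩
    refine ⟨((A⁻¹ : Matrix.SpecialLinearGroup (Fin 2) (ZMod N)) : Matrix _ _ _) *ᵥ v, ?_⟩
    have h1 := h (((A⁻¹ : Matrix.SpecialLinearGroup (Fin 2) (ZMod N)) : Matrix _ _ _) *ᵥ v)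
    rw [Matrix.mulVec_mulVec, ← Matrix.SpecialLinearGroup.coe_mul, mul_inv_cancel,
      Matrix.SpecialLinearGroup.coe_one, Matrix.one_mulVec, ← hv] at h1
    exact (mul_left_cancel (mul_right_cancel h1)).symm

lemma projWeyl_conj (u v : Fin 2 → ZMod N) :
    projWeyl N u * projWeyl N v * (projWeyl N u)⁻¹ = projWeyl N v := by
  rw [← projWeyl_neg, ← projWeyl_add, ← projWeyl_add]
  congr 1
  abel

/-- If `g ^ N = 1` and `V` commutes with `g` up to a phase, then that phase is an `N`-th root of
unity. -/
lemma exists_mul_eq_toCircle {V g : U N} (hg : g ^ N = 1)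
    (h : (V : PU N) * g * (V : PU N)⁻¹ = g) :
    ∃ a : ZMod N, V * g = scalar N (ZMod.toCircle a) * (g * V) := by
  obtain ⟨c, hc⟩ : PhaseEq (V * g * V⁻¹) g := phaseEq_iff.2 h
  have hcN : c ^ N = 1 := by
    have h1 : (V * g * V⁻¹) ^ N = 1 := by rw [conj_pow, hg, mul_one, mul_inv_cancel]
    rw [hc, (scalar_comm c g).mul_pow, hg, mul_one, ← scalar_pow, ← scalar_one] at h1
    exact scalar_injective h1
  obtain ⟨a, ha⟩ : ∃ a : ZMod N, c = ZMod.toCircle a := by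
    have hprim := Complex.isPrimitiveRoot_exp N (NeZero.ne N)
    obtain ⟨k, -, hk⟩ := hprim.eq_pow_of_pow_eq_one (ξ := (c : ℂ))
      (by rw [← Circle.coe_pow, hcN, Circle.coe_one])
    refine ⟨k, ?_⟩
    ext
    rw [← hk, ZMod.toCircle_natCast, ← Complex.exp_nat_mul]
    congr 1
    ring
  exact ⟨a, by rw [← ha, ← mul_assoc, ← hc]; simp⟩

/-- A unitary operator fixing all displacement operators up to phase is itself a displacement
operator up to phase. -/
lemma implements_one_iff {V : U N} : Implements V 1 ↔ V ∈ heisenberg N := by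
  constructor
  · intro h
    have hX := h ![1, 0]
    have hZ := h ![0, 1]
    rw [Matrix.one_mulVec, projWeyl_shift] at hX
    rw [Matrix.one_mulVec, projWeyl_clock] at hZ
    obtain ⟨a, ha⟩ := exists_mul_eq_toCircle shift_pow_card hX
    obtain ⟨b, hb⟩ := exists_mul_eq_toCircle clock_pow_card hZ
    -- `W(b, -a)` acts on `X` and `Z` by the same phases as `V`
    have hsX := mul_eq_scalar_mul_congr (phaseEq_refl (weylVec N ![b, -a]))
      (phaseEq_iff.2 projWeyl_shift.symm) (weylVec_mul_comm ![b, -a] ![1, 0])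
    have hsZ := mul_eq_scalar_mul_congr (phaseEq_refl (weylVec N ![b, -a]))
      (phaseEq_iff.2 projWeyl_clock.symm) (weylVec_mul_comm ![b, -a] ![0, 1])
    rw [show symp ![b, -a] ![1, 0] = a by simp [symp]] at hsX
    rw [show symp ![b, -a] ![0, 1] = b by simp [symp]] at hsZ
    have key : ∀ (W g : U N) (c : Circle), V * g = scalar N c * (g * V) →
        W * g = scalar N c * (g * W) → Commute (W⁻¹ * V) g := by
      intro W g c h1 h2
      rw [commute_iff_eq, mul_assoc, h1, inv_mul_eq_iff_eq_mul, ← mul_assoc, ← mul_assoc,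
        ← mul_assoc, h2]
      simp [mul_assoc]
    obtain ⟨c, hc⟩ := exists_eq_scalar_of_commute (key _ _ _ ha hsX) (key _ _ _ hb hsZ)
    rw [inv_mul_eq_iff_eq_mul] at hc
    rw [hc]
    exact mul_mem (weylVec_mem_heisenberg _) (scalar_mem_heisenberg c)
  · intro h u
    obtain ⟨v, hv⟩ := mem_heisenberg_iff.1 h
    rw [hv, projWeyl_conj, Matrix.one_mulVec]

/-! ### Clifford operators implementing generators -/

lemma tau_pow_two (N : ℕ) : tau N ^ 2 = omega N := by
  rw [tau, omega, neg_sq, sq, ← Circle.exp_add]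
  congr 1
  ring

lemma tau_zpow_two (N : ℕ) : tau N ^ (2 : ℤ) = omega N := tau_pow_two N

/-- For even `N`, the phase `τ^(j²)` depends only on `j` modulo `N`. -/
lemma tau_pow_sq_congr (hN : Even N) {a b : ℤ} (h : (a : ZMod N) = b) :
    tau N ^ (a ^ 2) = tau N ^ (b ^ 2) := by
  obtain ⟨t, ht⟩ := (ZMod.intCast_eq_intCast_iff_dvd_sub _ _ _).1 h
  obtain ⟨m, hm⟩ := hN
  have hb : b ^ 2 = a ^ 2 + 2 * (N * (a * t + m * t ^ 2)) := by
    have : (N : ℤ) = m + m := by exact_mod_cast hm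
    rw [show b = a + N * t by linarith]
    have : (N : ℤ) * N = 2 * N * m := by rw [this]; ring
    linear_combination t ^ 2 * this
  have h1 : omega N ^ ((N : ℤ)) = 1 := by rw [omega_zpow]; simp
  rw [hb, zpow_add, zpow_mul (tau N) 2, zpow_ofNat, tau_pow_two, zpow_mul, h1, one_zpow, mul_one]

/-- A diagonal unitary operator with entries given by phases. -/
def diagUnitary (d : ZMod N → Circle) : U N :=
  ⟨Matrix.diagonal fun j => (d j : ℂ), by
    rw [Matrix.mem_unitaryGroup_iff, Matrix.star_eq_conjTranspose, Matrix.diagonal_conjTranspose,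
      Matrix.diagonal_mul_diagonal, ← Matrix.diagonal_one]
    congr 1
    funext i
    rw [Pi.star_apply, Complex.star_def, Complex.mul_conj, Circle.normSq_coe, Complex.ofReal_one]⟩

variable (N) in
/-- The diagonal operator `|j⟩ ↦ τ^(j²) |j⟩`. -/
def phaseGate : U N := diagUnitary fun j => tau N ^ ((j.val : ℤ) ^ 2)

variable (N) in
/-- The parity operator `|j⟩ ↦ |-j⟩`. -/
def parity : U N :=
  ⟨Matrix.of fun i j : ZMod N => if i = -j then (1 : ℂ) else 0, by
    rw [Matrix.mem_unitaryGroup_iff]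
    ext i k
    rw [Matrix.mul_apply, Finset.sum_eq_single (-i)]
    · simp [Matrix.star_apply, Matrix.one_apply, eq_comm]
    · intro j _ hj
      have h : i ≠ -j := fun h => hj (by rw [h, neg_neg])
      simp [h]
    · simp⟩

lemma sum_toCircle_mul (a : ZMod N) :
    ∑ j : ZMod N, ((ZMod.toCircle (j * a) : Circle) : ℂ) = if a = 0 then (N : ℂ) else 0 := by
  have := AddChar.sum_mulShift a (ZMod.isPrimitive_stdAddChar N)
  simpa [ZMod.stdAddChar_apply, ZMod.card] using this

variable (N) in
/-- The discrete Fourier transform `|j⟩ ↦ N^(-1/2) ∑ₖ ω^(jk) |k⟩`. -/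
def fourierGate : U N :=
  ⟨Matrix.of fun i j : ZMod N => ((Real.sqrt N)⁻¹ : ℂ) * ZMod.toCircle (i * j), by
    rw [Matrix.mem_unitaryGroup_iff]
    have hN : (N : ℂ) ≠ 0 := Nat.cast_ne_zero.2 (NeZero.ne N)
    have hs : ((Real.sqrt N : ℝ) : ℂ) * (Real.sqrt N : ℝ) = N := by
      rw [← Complex.ofReal_mul, Real.mul_self_sqrt (Nat.cast_nonneg N), Complex.ofReal_natCast]
    ext i k
    have hterm : ∀ j : ZMod N, ((Real.sqrt N)⁻¹ : ℂ) * ZMod.toCircle (i * j) *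
        star (((Real.sqrt N)⁻¹ : ℂ) * ZMod.toCircle (k * j)) =
        (N : ℂ)⁻¹ * ZMod.toCircle (j * (i - k)) := by
      intro j
      rw [show j * (i - k) = i * j + -(k * j) by ring, AddChar.map_add_eq_mul,
        AddChar.map_neg_eq_inv, Circle.coe_mul, Circle.coe_inv_eq_conj, ← hs, Complex.star_def,
        map_mul (starRingEnd ℂ), map_inv₀, Complex.conj_ofReal, mul_inv]
      ring
    simp only [Matrix.mul_apply, Matrix.star_apply, Matrix.of_apply]
    rw [Finset.sum_congr rfl fun j _ => hterm j, ← Finset.mul_sum, sum_toCircle_mul]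
    by_cases h : i = k
    · subst h; simp [hN]
    · simp [h, sub_ne_zero.2 h]⟩

lemma phaseGate_coe : ((phaseGate N : U N) : Matrix (ZMod N) (ZMod N) ℂ) =
    Matrix.diagonal fun j => ((tau N ^ ((j.val : ℤ) ^ 2) : Circle) : ℂ) := rfl

lemma parity_apply (i j : ZMod N) :
    (parity N : Matrix (ZMod N) (ZMod N) ℂ) i j = if i = -j then 1 else 0 := rfl

lemma fourierGate_apply (i j : ZMod N) :
    (fourierGate N : Matrix (ZMod N) (ZMod N) ℂ) i j =
      ((Real.sqrt N)⁻¹ : ℂ) * ZMod.toCircle (i * j) := rfl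

lemma conj_eq_of_mul_eq {V A B C : U N} {c : Circle} (h : B * (V * A) = scalar N c * (C * V)) :
    (V : PU N) * A * (V : PU N)⁻¹ = (B : PU N)⁻¹ * C := by
  rw [mul_inv_eq_iff_eq_mul, mul_assoc, eq_inv_mul_iff_mul_eq, ← QuotientGroup.mk_mul,
    ← QuotientGroup.mk_mul, h, QuotientGroup.mk_mul, mk_scalar, one_mul, QuotientGroup.mk_mul]

lemma phaseGate_mul_clock : phaseGate N * clock N = clock N * phaseGate N := by
  ext i j
  simp only [Submonoid.coe_mul]
  rw [mul_clock_apply, clock_mul_apply, phaseGate_coe, Matrix.diagonal_apply]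
  split_ifs with h
  · subst h; ring
  · simp

lemma clock_mul_phaseGate_mul_shift (hN : Even N) :
    clock N * (phaseGate N * shift N) = scalar N (tau N)⁻¹ * (shift N * phaseGate N) := by
  ext i j
  simp only [Submonoid.coe_mul]
  rw [clock_mul_apply, scalar_mul_apply, shift_mul_apply, mul_shift_apply, phaseGate_coe,
    Matrix.diagonal_apply, Matrix.diagonal_apply]
  by_cases h : i = j - 1
  · have h' : i + 1 = j := by rw [h, sub_add_cancel]
    rw [if_pos h, if_pos h', ← Circle.coe_mul, ← Circle.coe_mul,
      tau_pow_sq_congr hN (a := (i + 1).val) (b := i.val + 1) (by simp),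
      show ((i.val : ℤ) + 1) ^ 2 = 1 + 2 * i.val + (i.val : ℤ) ^ 2 by ring, zpow_add, zpow_add,
      zpow_mul, tau_zpow_two, zpow_one, omega_zpow, Int.cast_natCast,
      ZMod.natCast_zmod_val, mul_assoc (tau N), inv_mul_cancel_left]
  · have h' : i + 1 ≠ j := fun h' => h (by rw [← h', add_sub_cancel_right])
    rw [if_neg h, if_neg h', mul_zero, mul_zero]

/-- The phase gate implements a transvection. -/
lemma implements_phaseGate (hN : Even N) : Implements (phaseGate N) !![1, 0; -1, 1] := by
  apply implements_of_generators
  · rw [conj_eq_of_mul_eq (clock_mul_phaseGate_mul_shift hN), ← projWeyl_clock, ← projWeyl_shift,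
      ← projWeyl_neg, ← projWeyl_add]
    simp
  · rw [conj_eq_of_mul_eq (B := 1) (c := 1) (C := clock N)
      (by rw [one_mul, scalar_one, one_mul, phaseGate_mul_clock]), projWeyl_clock]
    simp

/-- The Fourier transform exchanges `X` and `Z` up to inversion. -/
lemma implements_fourierGate : Implements (fourierGate N) !![0, 1; -1, 0] := by
  apply implements_of_generators
  · rw [conj_eq_of_mul_eq (B := clock N) (c := 1) (C := 1), ← projWeyl_clock, ← projWeyl_neg]
    · simp
    · rw [scalar_one, one_mul, one_mul]
      ext i j
      simp only [Submonoid.coe_mul]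
      rw [clock_mul_apply, mul_shift_apply, fourierGate_apply, fourierGate_apply, mul_left_comm,
        ← Circle.coe_mul, ← AddChar.map_add_eq_mul]
      ring_nf
  · rw [conj_eq_of_mul_eq (B := 1) (c := 1) (C := shift N), projWeyl_shift]
    · simp
    · rw [scalar_one, one_mul, one_mul]
      ext i j
      simp only [Submonoid.coe_mul]
      rw [shift_mul_apply, mul_clock_apply, fourierGate_apply, fourierGate_apply, mul_assoc,
        ← Circle.coe_mul, ← AddChar.map_add_eq_mul]
      ring_nf

lemma implements_parity : Implements (parity N) !![-1, 0; 0, -1] := by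
  apply implements_of_generators
  · rw [conj_eq_of_mul_eq (B := shift N) (c := 1) (C := 1), ← projWeyl_shift, ← projWeyl_neg]
    · simp
    · rw [scalar_one, one_mul, one_mul]
      ext i j
      simp only [Submonoid.coe_mul]
      rw [shift_mul_apply, mul_shift_apply, parity_apply, parity_apply]
      congr 1
      rw [neg_sub, sub_eq_neg_add, add_left_inj]
  · rw [conj_eq_of_mul_eq (B := clock N) (c := 1) (C := 1), ← projWeyl_clock, ← projWeyl_neg]
    · simp
    · rw [scalar_one, one_mul, one_mul]
      ext i j
      simp only [Submonoid.coe_mul]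
      rw [clock_mul_apply, mul_clock_apply, parity_apply]
      split_ifs with h
      · rw [h, one_mul, ← Circle.coe_mul, ← AddChar.map_add_eq_mul]
        simp
      · simp

lemma parity_mul_phaseGate (hN : Even N) : parity N * phaseGate N = phaseGate N * parity N := by
  ext i j
  simp only [Submonoid.coe_mul]
  rw [phaseGate_coe, Matrix.mul_diagonal, Matrix.diagonal_mul, parity_apply]
  split_ifs with h
  · rw [h, tau_pow_sq_congr hN (a := (-j).val) (b := -j.val) (by simp), neg_sq, one_mul, mul_one]
  · simp

/-- The `N`-th power of the matrix implemented by the phase gate is `1`, but that of the gate itself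
is `Z^(N/2)`, which is not a scalar. This is the source of the obstruction to splitting. -/
lemma phaseGate_pow {m : ℕ} (hm : N = 2 * m) : phaseGate N ^ N = clock N ^ m := by
  ext i j
  rw [diagonal_pow_coe phaseGate_coe, diagonal_pow_coe clock_coe, Matrix.diagonal_apply,
    Matrix.diagonal_apply]
  split_ifs
  · rw [Pi.pow_apply, Pi.pow_apply, ← Circle.coe_pow, ← Circle.coe_pow]
    congr 1
    obtain ⟨t, ht⟩ : ∃ t, i.val * i.val = i.val + 2 * t := by
      obtain ⟨t, ht⟩ := even_iff_two_dvd.1 (Nat.even_mul_pred_self i.val)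
      refine ⟨t, ?_⟩
      rw [← ht]
      cases i.val with
      | zero => rfl
      | succ k => simp; ring
    have e1 : (tau N ^ ((i.val : ℤ) ^ 2)) ^ N = omega N ^ (i.val * i.val * m) := by
      rw [← zpow_natCast, ← zpow_mul, ← tau_pow_two, ← pow_mul, ← zpow_natCast]
      congr 1
      have hm' : (N : ℤ) = 2 * m := by exact_mod_cast hm
      push_cast
      linear_combination (i.val : ℤ) ^ 2 * hm'
    rw [e1, ht, show (i.val + 2 * t) * m = i.val * m + N * t by
        linear_combination t * hm.symm, pow_add, pow_mul,
      pow_mul, omega_pow, omega_pow, ZMod.natCast_self, ZMod.natCast_zmod_val,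
      AddChar.map_zero_eq_one, one_pow, mul_one]
  · rfl

/-! ### Non-splitting -/

/-- Powers of a general lift of the matrix implemented by the phase gate. -/
lemma projWeyl_mul_phaseGate_pow (hN : Even N) (u : Fin 2 → ZMod N) (n : ℕ) :
    (projWeyl N u * (phaseGate N : U N)) ^ n =
      projWeyl N ![n * u 0, n * u 1 - n.choose 2 * u 0] * (phaseGate N : U N) ^ n := by
  induction n with
  | zero =>
    rw [pow_zero, pow_zero, mul_one]
    simp only [Nat.cast_zero, zero_mul, Nat.choose_zero_succ, sub_zero]
    rw [show (![0, 0] : Fin 2 → ZMod N) = 0 by ext i; fin_cases i <;> rfl, projWeyl_zero]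
  | succ n ih =>
    have h := implements_phaseGate hN ![n * u 0, n * u 1 - n.choose 2 * u 0]
    rw [mul_inv_eq_iff_eq_mul] at h
    rw [pow_succ', ih, mul_assoc, ← mul_assoc ((phaseGate N : U N) : PU N), h, mul_assoc,
      ← pow_succ', ← mul_assoc, ← projWeyl_add]
    congr 2
    ext i
    fin_cases i
    · simp
      ring
    · simp [Nat.choose_succ_succ']
      ring

/-- The obstruction to splitting: lifts of the commuting matrices `[1, 0; -1, 1]` and `-1` cannot
commute if the former has order dividing `N`. -/
lemma not_commute_of_pow_eq_one (hN : 4 ∣ N) {a b : U N}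
    (ha : a * (phaseGate N)⁻¹ ∈ heisenberg N) (hb : b * (parity N)⁻¹ ∈ heisenberg N)
    (haN : a ^ N = 1) : ¬ Commute a b := by
  intro hab
  obtain ⟨n, hn⟩ := hN
  have heven : Even N := ⟨2 * n, by omega⟩
  obtain ⟨u, hu⟩ := mem_heisenberg_iff.1 ha
  obtain ⟨v, hv⟩ := mem_heisenberg_iff.1 hb
  rw [QuotientGroup.mk_mul, QuotientGroup.mk_inv, mul_inv_eq_iff_eq_mul] at hu hv
  -- commutation of the lifts forces `2 u₀ = 0`
  have h2 : 2 * u 0 = 0 := by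
    have h := congrArg (fun A : U N => (A : PU N)) hab.eq
    simp only [QuotientGroup.mk_mul] at h
    have hD := implements_phaseGate heven v
    have hP := implements_parity (N := N) u
    rw [mul_inv_eq_iff_eq_mul] at hD hP
    have hDP := congrArg (fun A : U N => (A : PU N)) (parity_mul_phaseGate heven)
    simp only [QuotientGroup.mk_mul] at hDP
    have e1 : (a : PU N) * b = projWeyl N (u + !![1, 0; -1, 1] *ᵥ v) *
        (((phaseGate N : U N) : PU N) * (parity N : U N)) := by
      rw [hu, hv, mul_assoc, ← mul_assoc _ (projWeyl N v), hD, projWeyl_add]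
      simp only [mul_assoc]
    have e2 : (b : PU N) * a = projWeyl N (v + !![-1, 0; 0, -1] *ᵥ u) *
        (((phaseGate N : U N) : PU N) * (parity N : U N)) := by
      rw [hu, hv, mul_assoc, ← mul_assoc _ (projWeyl N u), hP, projWeyl_add, ← hDP]
      simp only [mul_assoc]
    rw [e1, e2] at h
    have h0 := congrFun (projWeyl_injective (mul_right_cancel h)) 0
    simp [Matrix.vecHead] at h0
    linear_combination h0
  -- while `a ^ N = 1` forces `N / 2 = N (N - 1) / 2 * u₀`, that is, `u₀` odd
  have h3 : ((2 * n : ℕ) : ZMod N) - N.choose 2 * u 0 = 0 := by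
    have h := congrArg (fun A : U N => (A : PU N)) haN
    simp only [QuotientGroup.mk_pow, QuotientGroup.mk_one] at h
    rw [hu, projWeyl_mul_phaseGate_pow heven, ← QuotientGroup.mk_pow _ (phaseGate N),
      phaseGate_pow (m := 2 * n) (by omega), QuotientGroup.mk_pow] at h
    have hz := projWeyl_natCast (N := N) 0 (2 * n)
    rw [pow_zero, one_mul] at hz
    rw [← hz, ← projWeyl_add] at h
    have h1 := congrFun (eq_zero_of_projWeyl_eq_one h) 1
    simp at h1
    push_cast
    linear_combination h1
  -- since `N (N - 1) / 2 * u₀ = (N - 1) n * (2 u₀)`, the equation `2 u₀ = 0` leaves `N / 2 = 0` in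
  -- `ℤ/N`
  have hch : N.choose 2 = 2 * n * (N - 1) := by
    rw [Nat.choose_two_right]
    apply Nat.div_eq_of_eq_mul_left two_pos
    rw [hn]; ring
  rw [hch] at h3
  have h4 : ((2 * n : ℕ) : ZMod N) = 0 := by
    push_cast at h3 ⊢
    linear_combination h3 + n * (N - 1 : ℕ) * h2
  rw [ZMod.natCast_eq_zero_iff] at h4
  have := NeZero.pos N
  have := Nat.le_of_dvd (by omega) h4
  omega

/-! ### The Clifford extension -/

/-- The symplectic matrix implemented by a Clifford operator. -/
def cliffordMatrix (V : clifford N) : Matrix.SpecialLinearGroup (Fin 2) (ZMod N) :=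
  (exists_implements_of_mem_clifford V.2).choose

lemma implements_cliffordMatrix (V : clifford N) : Implements (V : U N) (cliffordMatrix V) :=
  (exists_implements_of_mem_clifford V.2).choose_spec

lemma cliffordMatrix_eq_iff {V : clifford N} {A : Matrix.SpecialLinearGroup (Fin 2) (ZMod N)} :
    cliffordMatrix V = A ↔ Implements (V : U N) A := by
  constructor
  · rintro rfl
    exact implements_cliffordMatrix V
  · intro h
    exact Subtype.ext ((implements_cliffordMatrix V).eq h)

variable (N) in
/-- The homomorphism `C(N) → SL(2, ℤ/N)`. -/
def cliffordHom : clifford N →* Matrix.SpecialLinearGroup (Fin 2) (ZMod N) :=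
  MonoidHom.mk' cliffordMatrix fun V V' => by
    rw [cliffordMatrix_eq_iff, Matrix.SpecialLinearGroup.coe_mul]
    exact (implements_cliffordMatrix V).mul (implements_cliffordMatrix V')

lemma cliffordHom_eq_iff {V : clifford N} {A : Matrix.SpecialLinearGroup (Fin 2) (ZMod N)} :
    cliffordHom N V = A ↔ Implements (V : U N) A := cliffordMatrix_eq_iff

lemma cliffordHom_surjective (hN : Even N) : Function.Surjective (cliffordHom N) := by
  rw [← MonoidHom.range_eq_top]
  have hT : Implements (phaseGate N) (lower (-1) : Matrix.SpecialLinearGroup _ (ZMod N)) :=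
    implements_phaseGate hN
  have hS : Implements (fourierGate N) (quarterTurn N) := implements_fourierGate
  exact eq_top_of_mem _ ⟨⟨_, hT.mem_clifford⟩, cliffordHom_eq_iff.2 hT⟩
    ⟨⟨_, hS.mem_clifford⟩, cliffordHom_eq_iff.2 hS⟩

lemma cliffordHom_eq_one_iff {V : clifford N} : cliffordHom N V = 1 ↔ (V : U N) ∈ heisenberg N := by
  rw [cliffordHom_eq_iff, Matrix.SpecialLinearGroup.coe_one, implements_one_iff]

/-- The extension `1 → H(N) → C(N) → SL(2, ℤ/N) → 1` for even `N`. -/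
def cliffordExtension (hN : Even N) : GroupExtension (heisenberg N) (clifford N)
    (Matrix.SpecialLinearGroup (Fin 2) (ZMod N)) where
  inl := incl N
  rightHom := cliffordHom N
  inl_injective := Subgroup.inclusion_injective _
  range_inl_eq_ker_rightHom := by
    ext V
    rw [MonoidHom.mem_ker, cliffordHom_eq_one_iff, incl, Subgroup.inclusion_range]
    rfl
  rightHom_surjective := cliffordHom_surjective hN

lemma isCliffordExtension_iff {S : GroupExtension (heisenberg N) (clifford N)
    (Matrix.SpecialLinearGroup (Fin 2) (ZMod N))} :
    IsCliffordExtension S ↔ S.inl = incl N ∧ S.rightHom = cliffordHom N := by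
  simp only [IsCliffordExtension, ← implements_iff, ← cliffordHom_eq_iff]
  refine and_congr_right fun _ => ⟨fun h => ?_, fun h V A => by rw [h]⟩
  ext1 V
  exact (h V _).2 rfl

lemma existsUnique_isCliffordExtension (hN : Even N) :
    ∃! S : GroupExtension (heisenberg N) (clifford N)
      (Matrix.SpecialLinearGroup (Fin 2) (ZMod N)), IsCliffordExtension S := by
  refine ⟨cliffordExtension hN, isCliffordExtension_iff.2 ⟨rfl, rfl⟩, ?_⟩
  intro S hS
  obtain ⟨h1, h2⟩ := isCliffordExtension_iff.1 hS
  cases S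
  simp only at h1 h2
  subst h1 h2
  rfl

lemma IsSemidirect.isRightSplit {H G K : Type*} [Group H] [Group G] [Group K]
    {S : GroupExtension H G K} (h : IsSemidirect S) : IsRightSplit S := by
  obtain ⟨φ, Φ, -, h2⟩ := h
  exact ⟨Φ.toMonoidHom.comp SemidirectProduct.inr, MonoidHom.ext h2⟩

/-- For `4 ∣ N`, no extension whose first map is the inclusion `H(N) → C(N)` is right split. The
quotient `K` is arbitrary, since only the images of the phase gate and the parity operator in
`C(N)/H(N)` matter. -/
lemma not_isRightSplit {K : Type*} [Group K] (hN : 4 ∣ N)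
    (S : GroupExtension (heisenberg N) (clifford N) K) (hS : S.inl = incl N) :
    ¬ IsRightSplit S := by
  rintro ⟨μ, hμ⟩
  have heven : Even N := even_iff_two_dvd.2 (dvd_trans (by norm_num) hN)
  have hker : ∀ V : clifford N, S.rightHom V = 1 ↔ (V : U N) ∈ heisenberg N := by
    intro V
    rw [← MonoidHom.mem_ker, ← S.range_inl_eq_ker_rightHom, hS, incl, Subgroup.inclusion_range]
    rfl
  have hT : Implements (phaseGate N) (lower (-1) : Matrix.SpecialLinearGroup _ (ZMod N)) :=
    implements_phaseGate heven
  have hP : Implements (parity N) (-1 : Matrix.SpecialLinearGroup (Fin 2) (ZMod N)) := by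
    convert implements_parity (N := N) using 1
    ext i j
    fin_cases i <;> fin_cases j <;> simp
  set D : clifford N := ⟨phaseGate N, hT.mem_clifford⟩ with hD
  set P : clifford N := ⟨parity N, hP.mem_clifford⟩ with hPdef
  have hμ' : ∀ V : clifford N, ((μ (S.rightHom V) * V⁻¹ : clifford N) : U N) ∈ heisenberg N := by
    intro V
    rw [← hker, map_mul, map_inv, mul_inv_eq_one]
    exact DFunLike.congr_fun hμ _
  have hDN : S.rightHom D ^ N = 1 := by
    rw [← map_pow, hker]
    obtain ⟨m, hm⟩ := heven
    have : ((D ^ N : clifford N) : U N) = clock N ^ m := phaseGate_pow (by omega)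
    rw [this]
    exact pow_mem clock_mem_heisenberg _
  have hDP : Commute D P := Subtype.ext (parity_mul_phaseGate heven).symm
  refine not_commute_of_pow_eq_one hN (hμ' D) (hμ' P) ?_ ?_
  · rw [← SubmonoidClass.coe_pow, ← map_pow, hDN, map_one]
    rfl
  · exact ((hDP.map S.rightHom).map μ).map (clifford N).subtype

end CliffordSplit

end

open CliffordSplit in
theorem corollary6p2 (N : ℕ) [NeZero N] (hN : N ≡ 0 [MOD 4]) :
    (¬ IsSemidirect (quotientExtension N) ∧ ¬ IsRightSplit (quotientExtension N)) ∧
      (∃! S : GroupExtension (heisenberg N) (clifford N)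
          (Matrix.SpecialLinearGroup (Fin 2) (ZMod N)), IsCliffordExtension S) ∧
      ∀ S : GroupExtension (heisenberg N) (clifford N)
          (Matrix.SpecialLinearGroup (Fin 2) (ZMod N)),
        IsCliffordExtension S → ¬ IsSemidirect S ∧ ¬ IsRightSplit S := by
  have h4 : 4 ∣ N := (Nat.modEq_zero_iff_dvd).1 hN
  have hq : ¬ IsRightSplit (quotientExtension N) := not_isRightSplit h4 _ rfl
  refine ⟨⟨fun h => hq h.isRightSplit, hq⟩,
    existsUnique_isCliffordExtension (even_iff_two_dvd.2 (dvd_trans (by norm_num) h4)), ?_⟩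
  intro S hS
  have hs := not_isRightSplit h4 S hS.1
  exact ⟨fun h => hs h.isRightSplit, hs⟩
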